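/- Let $\mathbb{T}=\mathbb{R}/\mathbb{Z}$ carry the metric $|x-y|=\min_{k\in\mathbb{Z}}|\tilde x-\tilde y+k|$ (where $\tilde x,\tilde y\in\mathbb{R}$ represent $x,y$) and its Haar probability measure $m$. Let $\mathbb{T}^N$ carry the product measure $m^N$ and the metric $|x-y|^N_\infty=\max_{1\le n\le N}|x_n-y_n|$. For $n\in[N]=\{1,\dots,N\}$ and a bounded measurable $f:\mathbb{T}^N\to\mathbb{R}$ put $$E_{[N]\setminus\{n\}}f(x_1,\dots,x_N)=\int_{\mathbb{T}}f(x_1,\dots,x_{n-1},y,x_{n+1},\dots,x_N)\,m(dy),$$ and for $S=[N]\setminus\{n_1,\dots,n_k\}$, with $n_1,\dots,n_k$ distinct, let $E_S=E_{[N]\setminus\{n_1\}}\circ\cdots\circ E_{[N]\setminus\{n_k\}}$ (the order is immaterial, and $E_{[N]}f=f$). For every $\varepsilon>0$ there is an integer $q\ge 1$ such that the following holds for every $N$: if $f:\mathbb{T}^N\to\mathbb{R}$ is $1$-Lipschitz for $|\cdot|^N_\infty$, then there is $S\subseteq[N]$ with $|S|\le q$ such that $$\|f-E_Sf\|_{L_1(\mathbb{T}^N,m^N)}<\varepsilon.$$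 -/

import Mathlib

open MeasureTheory

/-- Integrating out the `n`-th coordinate: the operator `E_{[N] \ {n}}`,
`(E_{[N] \ {n}} f)(x) = ∫ f(x₁, …, xₙ₋₁, y, xₙ₊₁, …, x_N) μ(dy)`. -/
noncomputable def integrateOut {X : Type*} [MeasurableSpace X] (μ : Measure X) {N : ℕ}
    (n : Fin N) (f : (Fin N → X) → ℝ) : (Fin N → X) → ℝ :=
  fun x => ∫ y, f (Function.update x n y) ∂μ

/-- The operator `E_S`: the composition of the operators `E_{[N] \ {n}}` over the coordinates
`n ∉ S`, so that only the dependence on the coordinates in `S` is retained.  The composition is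
written in increasing order of `n`; for functions integrable enough for Fubini's theorem, such as
bounded measurable ones, the order is immaterial. -/
noncomputable def condExpOn {X : Type*} [MeasurableSpace X] (μ : Measure X) {N : ℕ}
    (S : Finset (Fin N)) (f : (Fin N → X) → ℝ) : (Fin N → X) → ℝ :=
  (Sᶜ.sort (· ≤ ·)).foldr (integrateOut μ) f

/-!
A function that is `1`-Lipschitz for the supremum distance has gradient of `ℓ¹` norm at most `1`
almost everywhere, so its total influence is bounded independently of the number of coordinates.
By an argument of Friedgut type, a function of bounded total influence is close to a function of
few coordinates.

The influence bound is `sum_integral_abs_increment_le`, which rests on Rademacher's theorem. It is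
carried over to a grid of fixed mesh `1 / M` in each coordinate, translated suitably
(`exists_translate_sum_coordLaplacian_le`). As the function is Lipschitz, sampling it on the grid
costs a uniform error `1 / M`, both for `f` and for `E_S f` (`abs_condExpOn_sub_le`), whatever the
number of coordinates.

On the finite grid, `exists_averageOutside_close` is Friedgut's theorem. Let `F` be the sampled
function, `S` the set of the coordinates `n` for which `F - E_n F` has mean absolute value at least
some `δ`; it has at most `1 / δ` elements. In the Efron-Stein decomposition of `F`, the squared
norm of `F - E_S F` is the weight of the sets `A` not contained in `S`. The large sets have little
weight because the total influence bounds the mean size of `A`. The small sets meet the complement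
of `S`, and their weight is controlled by the squared norms of `T (F - E_n F)` for `n` outside `S`,
where `T` is a noise operator. These are small because `T` is hypercontractive
(`sum_noiseOp_pow_four_le`, and `sq_sum_noiseOp_sq_le` for its dual form): it gains a power of `δ`
over the influence. The noise may be chosen strong in terms of `M`, which makes the
one-coordinate case of hypercontractivity elementary.
-/

/-! ### Tensor products of matrices -/

/-- The tensor product of the square matrices `κ n`, acting on functions on the product space
`∀ n, X`. -/
def tensorMatrix {ι X : Type*} [Fintype ι] (κ : ι → Matrix X X ℝ) : Matrix (ι → X) (ι → X) ℝ :=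
  Matrix.of fun x y => ∏ n, κ n (x n) (y n)


theorem tensorMatrix_mul {ι X : Type*} [Fintype ι] [DecidableEq ι] [Fintype X]
    (κ κ' : ι → Matrix X X ℝ) :
    tensorMatrix κ * tensorMatrix κ' = tensorMatrix (κ * κ') := by
  ext x y
  simp only [tensorMatrix, Matrix.mul_apply, Matrix.of_apply, Pi.mul_apply]
  rw [Finset.prod_univ_sum, Fintype.piFinset_univ]
  exact Finset.sum_congr rfl fun z _ => Finset.prod_mul_distrib.symm

theorem tensorMatrix_transpose {ι X : Type*} [Fintype ι] (κ : ι → Matrix X X ℝ) :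
    (tensorMatrix κ).transpose = tensorMatrix fun n => (κ n).transpose := by
  ext x y
  simp [tensorMatrix]

theorem tensorMatrix_one {ι X : Type*} [Fintype ι] [DecidableEq X] [DecidableEq (ι → X)] :
    tensorMatrix (1 : ι → Matrix X X ℝ) = 1 := by
  ext x y
  simp only [tensorMatrix, Matrix.of_apply, Pi.one_apply, Matrix.one_apply, Finset.prod_ite_zero]
  simp [funext_iff]

/-- Expansion of a tensor product of sums, the operator form of the Efron-Stein decomposition. -/
theorem tensorMatrix_add_eq_sum {ι X : Type*} [Fintype ι] [DecidableEq ι]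
    (a b : ι → ℝ) (p q : Matrix X X ℝ) :
    tensorMatrix (fun n => a n • p + b n • q) =
      ∑ A : Finset ι, ((∏ n ∈ A, b n) * ∏ n ∈ Aᶜ, a n) •
        tensorMatrix fun n => if n ∈ A then q else p := by
  ext x y
  simp only [tensorMatrix, Matrix.of_apply, Matrix.add_apply, Matrix.smul_apply, Matrix.sum_apply,
    smul_eq_mul]
  rw [Finset.prod_congr rfl fun n _ => add_comm (a n * _) _, Finset.prod_add, Finset.powerset_univ]
  refine Finset.sum_congr rfl fun A _ => ?_
  rw [Finset.prod_mul_distrib, Finset.prod_mul_distrib, ← Finset.compl_eq_univ_sdiff,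
    ← Finset.prod_mul_prod_compl A (fun n => (if n ∈ A then q else p) (x n) (y n)),
    Finset.prod_congr rfl fun n (hn : n ∈ A) =>
      show (if n ∈ A then q else p) (x n) (y n) = q (x n) (y n) by rw [if_pos hn],
    Finset.prod_congr rfl fun n (hn : n ∈ Aᶜ) =>
      show (if n ∈ A then q else p) (x n) (y n) = p (x n) (y n) by
        rw [if_neg (Finset.mem_compl.1 hn)]]
  ring

theorem mulVec_dotProduct_mulVec {Y : Type*} [Fintype Y] (Q Q' : Matrix Y Y ℝ) (F F' : Y → ℝ) :
    Q.mulVec F ⬝ᵥ Q'.mulVec F' = F ⬝ᵥ (Q.transpose * Q').mulVec F' := by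
  rw [Matrix.dotProduct_mulVec, Matrix.vecMul_mulVec, Matrix.dotProduct_mulVec]

/-! ### Averaging, noise and spectral weights on a finite product space -/

/-- The matrix with all entries `1 / |X|`: averaging over the uniform distribution on `X`. -/
noncomputable def averagingMatrix (X : Type*) [Fintype X] : Matrix X X ℝ :=
  Matrix.of fun _ _ => (Fintype.card X : ℝ)⁻¹

/-- The matrix of the noise operator that replaces a point of `X` by a uniformly random one with
probability `1 - ρ`; it multiplies functions of mean zero by `ρ`. -/
noncomputable def noiseMatrix (X : Type*) [Fintype X] [DecidableEq X] (ρ : ℝ) : Matrix X X ℝ :=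
  averagingMatrix X + ρ • (1 - averagingMatrix X)

theorem averagingMatrix_transpose (X : Type*) [Fintype X] :
    (averagingMatrix X).transpose = averagingMatrix X := rfl

theorem averagingMatrix_mul_self (X : Type*) [Fintype X] [Nonempty X] :
    averagingMatrix X * averagingMatrix X = averagingMatrix X := by
  ext x y
  simp [averagingMatrix, Matrix.mul_apply]

theorem averagingMatrix_mulVec {X : Type*} [Fintype X] (v : X → ℝ) (x : X) :
    (averagingMatrix X).mulVec v x = (∑ y, v y) / Fintype.card X := by
  simp [averagingMatrix, Matrix.mulVec, dotProduct, ← Finset.mul_sum, div_eq_inv_mul]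

section Weights

variable {ι X : Type*} [Fintype ι] [DecidableEq ι] [Fintype X] [DecidableEq X]

/-- The spectral weight of `F` at the set of coordinates `A`: the squared norm of the component of
`F` in the Efron-Stein decomposition which depends exactly on the coordinates in `A`. -/
noncomputable def spectralWeight (F : (ι → X) → ℝ) (A : Finset ι) : ℝ :=
  F ⬝ᵥ (tensorMatrix fun n => if n ∈ A then 1 - averagingMatrix X else averagingMatrix X).mulVec F

/-- The operator defining the spectral weight is an orthogonal projection. -/
theorem spectralWeight_nonneg [Nonempty X] (F : (ι → X) → ℝ) (A : Finset ι) :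
    0 ≤ spectralWeight F A := by
  have hP := averagingMatrix_mul_self X
  set κ : ι → Matrix X X ℝ := fun n => if n ∈ A then 1 - averagingMatrix X else averagingMatrix X
    with hκ
  have h1 : (tensorMatrix κ).transpose * tensorMatrix κ = tensorMatrix κ := by
    rw [tensorMatrix_transpose, tensorMatrix_mul]
    congr 1
    funext n
    simp only [hκ, Pi.mul_apply]
    split_ifs
    · rw [Matrix.transpose_sub, Matrix.transpose_one, averagingMatrix_transpose, sub_mul, mul_sub,
        mul_sub, hP]
      simp
    · rw [averagingMatrix_transpose, hP]
  have h2 := mulVec_dotProduct_mulVec (tensorMatrix κ) (tensorMatrix κ) F F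
  rw [h1] at h2
  rw [spectralWeight, ← h2]
  exact Finset.sum_nonneg fun _ _ => mul_self_nonneg _

/-- Every tensor product of combinations of `E` and `1 - E` is diagonal in the Efron-Stein
decomposition. All quadratic forms below are evaluated by choosing the coefficients. -/
theorem dotProduct_tensorMatrix_mulVec (F : (ι → X) → ℝ) (a b : ι → ℝ) :
    F ⬝ᵥ (tensorMatrix fun n => a n • averagingMatrix X + b n • (1 - averagingMatrix X)).mulVec F =
      ∑ A : Finset ι, ((∏ n ∈ A, b n) * ∏ n ∈ Aᶜ, a n) * spectralWeight F A := by
  rw [tensorMatrix_add_eq_sum, Matrix.sum_mulVec, dotProduct_sum]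
  refine Finset.sum_congr rfl fun A _ => ?_
  rw [Matrix.smul_mulVec, dotProduct_smul, smul_eq_mul, spectralWeight]

/-- Averaging over the coordinates outside `S`. -/
noncomputable def averageOutside (S : Finset ι) (F : (ι → X) → ℝ) : (ι → X) → ℝ :=
  (tensorMatrix fun n => if n ∈ S then 1 else averagingMatrix X).mulVec F

/-- The Laplacian `F - E_n F` in the coordinate `n`, that is, `F` minus its average over this
coordinate. -/
noncomputable def coordLaplacian (n : ι) (F : (ι → X) → ℝ) : (ι → X) → ℝ :=
  (tensorMatrix fun m => if m = n then 1 - averagingMatrix X else 1).mulVec F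

/-- The noise operator on functions on the product space, acting on each coordinate. -/
noncomputable def noiseOp (ρ : ℝ) (F : (ι → X) → ℝ) : (ι → X) → ℝ :=
  (tensorMatrix fun _ => noiseMatrix X ρ).mulVec F

/-- The tensor product of `K` in the coordinate `n` with identities elsewhere acts in the
coordinate `n` only. -/
theorem tensorMatrix_ite_mulVec (K : Matrix X X ℝ) (n : ι) (F : (ι → X) → ℝ) (x : ι → X) :
    (tensorMatrix fun m => if m = n then K else 1).mulVec F x =
      ∑ y, K (x n) y * F (Function.update x n y) := by
  rw [Matrix.mulVec, dotProduct]
  refine (Finset.sum_of_injOn (fun y => Function.update x n y)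
    (Function.update_injective x n).injOn (fun _ _ => Finset.mem_coe.2 (Finset.mem_univ _))
    (fun z _ hz => ?_) fun y _ => ?_).symm
  · have hne : ∃ m, m ≠ n ∧ x m ≠ z m := by
      by_contra! hall
      refine hz ⟨z n, Finset.mem_coe.2 (Finset.mem_univ _), ?_⟩
      funext m
      by_cases hm : m = n
      · subst hm
        simp
      · simp [hm, hall m hm]
    obtain ⟨m, hm, hxz⟩ := hne
    rw [tensorMatrix, Matrix.of_apply, Finset.prod_eq_zero (Finset.mem_univ m), zero_mul]
    rw [if_neg hm, Matrix.one_apply_ne hxz]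
  · rw [tensorMatrix, Matrix.of_apply, Finset.prod_eq_single n]
    · simp
    · intro m _ hm
      rw [if_neg hm, Function.update_of_ne hm, Matrix.one_apply_eq]
    · simp

theorem coordLaplacian_apply (n : ι) (F : (ι → X) → ℝ) (x : ι → X) :
    coordLaplacian n F x = F x - (∑ y, F (Function.update x n y)) / Fintype.card X := by
  rw [coordLaplacian, tensorMatrix_ite_mulVec]
  simp only [Matrix.sub_apply, sub_mul, Finset.sum_sub_distrib, averagingMatrix, Matrix.of_apply,
    Matrix.one_apply, ← Finset.mul_sum]
  simp [div_eq_inv_mul]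

theorem abs_coordLaplacian_le [Nonempty X] (n : ι) (F : (ι → X) → ℝ) (x : ι → X) :
    |coordLaplacian n F x| ≤ (∑ y, |F (Function.update x n y) - F x|) / Fintype.card X := by
  have hM : (0 : ℝ) < Fintype.card X := by exact_mod_cast Fintype.card_pos
  have : coordLaplacian n F x = (∑ y, (F x - F (Function.update x n y))) / Fintype.card X := by
    rw [coordLaplacian_apply, Finset.sum_sub_distrib, sub_div, Finset.sum_const, nsmul_eq_mul,
      Finset.card_univ, mul_div_cancel_left₀ _ hM.ne']
  rw [this, abs_div, abs_of_pos hM]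
  gcongr
  refine (Finset.abs_sum_le_sum_abs _ _).trans (Finset.sum_le_sum fun y _ => ?_)
  rw [abs_sub_comm]

theorem sum_sq_sub_averageOutside [Nonempty X] (F : (ι → X) → ℝ) (S : Finset ι) :
    ∑ x, (F x - averageOutside S F x) ^ 2 =
      ∑ A : Finset ι, (if A ⊆ S then 0 else 1) * spectralWeight F A := by
  have hP := averagingMatrix_mul_self X
  set κ : ι → Matrix X X ℝ := fun n => if n ∈ S then 1 else averagingMatrix X with hκ
  have h1 : (tensorMatrix κ).transpose * tensorMatrix κ = tensorMatrix κ := by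
    rw [tensorMatrix_transpose, tensorMatrix_mul]
    congr 1
    funext n
    simp only [hκ, Pi.mul_apply]
    split_ifs
    · simp
    · rw [averagingMatrix_transpose, hP]
  have h2 : averageOutside S F ⬝ᵥ averageOutside S F = F ⬝ᵥ averageOutside S F := by
    have := mulVec_dotProduct_mulVec (tensorMatrix κ) (tensorMatrix κ) F F
    rwa [h1] at this
  have h3 : ∑ x, (F x - averageOutside S F x) ^ 2 = F ⬝ᵥ F - F ⬝ᵥ averageOutside S F := by
    have : ∑ x, (F x - averageOutside S F x) ^ 2 =
        F ⬝ᵥ F - 2 * (F ⬝ᵥ averageOutside S F) + averageOutside S F ⬝ᵥ averageOutside S F := by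
      simp only [dotProduct, Finset.mul_sum]
      rw [← Finset.sum_sub_distrib, ← Finset.sum_add_distrib]
      exact Finset.sum_congr rfl fun x _ => by ring
    rw [this, h2]
    ring
  have h4 : F ⬝ᵥ F = ∑ A : Finset ι, spectralWeight F A := by
    have := dotProduct_tensorMatrix_mulVec F (1 : ι → ℝ) 1
    simp only [Pi.one_apply, one_smul, add_sub_cancel, Finset.prod_const_one, one_mul] at this
    rw [← this, show (fun _ : ι => (1 : Matrix X X ℝ)) = 1 from rfl, tensorMatrix_one,
      Matrix.one_mulVec]
  have h5 : F ⬝ᵥ averageOutside S F =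
      ∑ A : Finset ι, (if A ⊆ S then 1 else 0) * spectralWeight F A := by
    have := dotProduct_tensorMatrix_mulVec F (1 : ι → ℝ) fun n => if n ∈ S then 1 else 0
    rw [show (fun n => (1 : ι → ℝ) n • averagingMatrix X +
      (if n ∈ S then (1 : ℝ) else 0) • (1 - averagingMatrix X)) = κ from ?_] at this
    · rw [averageOutside, this]
      refine Finset.sum_congr rfl fun A _ => ?_
      simp only [Pi.one_apply, Finset.prod_const_one, mul_one, Finset.prod_ite_zero]
      simp only [← Finset.subset_iff]
    · funext n
      simp only [hκ, Pi.one_apply, one_smul]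
      split_ifs <;> simp
  rw [h3, h4, h5, ← Finset.sum_sub_distrib]
  refine Finset.sum_congr rfl fun A _ => ?_
  split_ifs <;> simp

/-- The noise operator damps the spectral weight at `A` by the factor `ρ ^ (2 * |A|)`, and the
Laplacian in the coordinate `n` keeps the weights at the sets containing `n`. -/
theorem noiseOp_coordLaplacian_dotProduct [Nonempty X] (ρ : ℝ) (F : (ι → X) → ℝ) (n : ι) :
    noiseOp ρ (coordLaplacian n F) ⬝ᵥ noiseOp ρ (coordLaplacian n F) =
      ∑ A : Finset ι, (if n ∈ A then ρ ^ (2 * A.card) else 0) * spectralWeight F A := by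
  have hP := averagingMatrix_mul_self X
  have h := dotProduct_tensorMatrix_mulVec F (fun m => if m = n then 0 else 1) fun _ => ρ ^ 2
  have h1 : noiseOp ρ (coordLaplacian n F) = (tensorMatrix fun m => noiseMatrix X ρ *
      if m = n then 1 - averagingMatrix X else 1).mulVec F := by
    rw [noiseOp, coordLaplacian, Matrix.mulVec_mulVec, tensorMatrix_mul]
    rfl
  rw [h1, mulVec_dotProduct_mulVec, tensorMatrix_transpose, tensorMatrix_mul]
  convert h using 4 with A m A hA
  · funext m
    obtain ⟨Q, hQ⟩ : ∃ Q, Q = 1 - averagingMatrix X := ⟨_, rfl⟩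
    have hQQ : Q * Q = Q := by
      rw [hQ, sub_mul, mul_sub, mul_sub, hP]
      simp
    have hPQ : averagingMatrix X * Q = 0 := by
      rw [hQ, mul_sub, hP]
      simp
    have hQP : Q * averagingMatrix X = 0 := by
      rw [hQ, sub_mul, hP]
      simp
    have hQt : Q.transpose = Q := by
      rw [hQ, Matrix.transpose_sub, Matrix.transpose_one, averagingMatrix_transpose]
    simp only [Pi.mul_apply, noiseMatrix, ← hQ]
    split_ifs
    · simp [add_mul, hPQ, hQQ, hQt, smul_smul, sq]
    · simp [add_mul, mul_add, hP, hPQ, hQP, hQQ, hQt, averagingMatrix_transpose, smul_smul, sq]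
  · rename_i A
    simp only [Finset.prod_ite_eq', Finset.prod_const]
    by_cases hn : n ∈ A <;> simp [hn, pow_mul]

theorem sum_sq_coordLaplacian [Nonempty X] (F : (ι → X) → ℝ) (n : ι) :
    ∑ x, coordLaplacian n F x ^ 2 =
      ∑ A : Finset ι, (if n ∈ A then 1 else 0) * spectralWeight F A := by
  have h := noiseOp_coordLaplacian_dotProduct 1 F n
  have h1 : noiseOp 1 (coordLaplacian n F) = coordLaplacian n F := by
    rw [noiseOp, noiseMatrix, one_smul, add_sub_cancel,
      show (fun _ : ι => (1 : Matrix X X ℝ)) = 1 from rfl, tensorMatrix_one, Matrix.one_mulVec]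
  simp only [h1, one_pow] at h
  rw [← h]
  exact Finset.sum_congr rfl fun x _ => sq _

end Weights

/-! ### Hypercontractivity of the noise operator -/

/-- One-coordinate hypercontractive inequality `‖T v‖₄ ≤ ‖v‖₂`, without normalization. Writing
`v = m + h` with `m` the mean of `v`, so that `T v = m + ρ h`, the inequality follows by expanding
the fourth power, from `∑ h = 0` and the trivial bound `∑ h⁴ ≤ (∑ h²)²`. -/
theorem sum_noiseMatrix_pow_four_le {X : Type*} [Fintype X] [DecidableEq X] [Nonempty X] {ρ : ℝ}
    (h1 : 4 * ρ ^ 2 ≤ 1) (h2 : 3 * ρ ^ 4 * Fintype.card X ≤ 1) (v : X → ℝ) :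
    Fintype.card X * ∑ x, (noiseMatrix X ρ).mulVec v x ^ 4 ≤ (∑ x, v x ^ 2) ^ 2 := by
  have hM : (0 : ℝ) < Fintype.card X := by exact_mod_cast Fintype.card_pos
  set M : ℝ := (Fintype.card X : ℝ) with hMd
  obtain ⟨m, hm⟩ : ∃ m, m = (∑ y, v y) / M := ⟨_, rfl⟩
  obtain ⟨h, hh⟩ : ∃ h : X → ℝ, h = fun x => v x - m := ⟨_, rfl⟩
  have hv : ∀ x, v x = m + h x := fun x => by rw [hh]; ring
  have hT : ∀ x, (noiseMatrix X ρ).mulVec v x = m + ρ * h x := fun x => by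
    rw [noiseMatrix, Matrix.add_mulVec, Matrix.smul_mulVec, Matrix.sub_mulVec, Matrix.one_mulVec]
    simp only [Pi.add_apply, Pi.smul_apply, Pi.sub_apply, averagingMatrix_mulVec, smul_eq_mul]
    rw [hv x, hm]
    ring
  have hsum : ∑ x, h x = 0 := by
    rw [hh, Finset.sum_sub_distrib, Finset.sum_const, nsmul_eq_mul, Finset.card_univ, ← hMd, hm]
    field_simp
    ring
  have hsq : ∑ x, v x ^ 2 = M * m ^ 2 + ∑ x, h x ^ 2 := by
    have : ∀ x, v x ^ 2 = m ^ 2 + 2 * m * h x + h x ^ 2 := fun x => by rw [hv x]; ring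
    simp only [this, Finset.sum_add_distrib, ← Finset.mul_sum, hsum]
    simp [hMd]
  have h4 : ∑ x, h x ^ 4 ≤ (∑ x, h x ^ 2) ^ 2 := by
    have := Finset.sum_sq_le_sq_sum_of_nonneg (s := Finset.univ) (f := fun x => h x ^ 2)
      fun x _ => sq_nonneg _
    simpa only [← pow_mul] using this
  have hle : ∑ x, (noiseMatrix X ρ).mulVec v x ^ 4 ≤
      M * m ^ 4 + 8 * m ^ 2 * ρ ^ 2 * ∑ x, h x ^ 2 + 3 * ρ ^ 4 * ∑ x, h x ^ 4 := by
    calc ∑ x, (noiseMatrix X ρ).mulVec v x ^ 4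
        ≤ ∑ x, (m ^ 4 + 4 * m ^ 3 * ρ * h x + 8 * m ^ 2 * ρ ^ 2 * h x ^ 2
            + 3 * ρ ^ 4 * h x ^ 4) := by
          refine Finset.sum_le_sum fun x _ => ?_
          rw [hT]
          -- This is `4 a b³ ≤ 2 a² b² + 2 b⁴`, with `a = m` and `b = ρ * h x`.
          nlinarith [mul_nonneg (sq_nonneg (ρ * h x)) (sq_nonneg (m - ρ * h x))]
      _ = _ := by
          simp only [Finset.sum_add_distrib, ← Finset.mul_sum, hsum]
          simp [hMd]
  have h0 : 0 ≤ ∑ x, h x ^ 2 := Finset.sum_nonneg fun _ _ => sq_nonneg _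
  have h40 : 0 ≤ ∑ x, h x ^ 4 := Finset.sum_nonneg fun _ _ => by positivity
  rw [hsq]
  generalize ∑ x, h x ^ 2 = s at *
  generalize ∑ x, h x ^ 4 = t at *
  calc M * ∑ x, (noiseMatrix X ρ).mulVec v x ^ 4
      ≤ M * (M * m ^ 4 + 8 * m ^ 2 * ρ ^ 2 * s + 3 * ρ ^ 4 * t) := by gcongr
    _ = M ^ 2 * m ^ 4 + (4 * ρ ^ 2) * (2 * M * m ^ 2 * s) + (3 * ρ ^ 4 * M) * t := by ring
    _ ≤ M ^ 2 * m ^ 4 + 1 * (2 * M * m ^ 2 * s) + 1 * s ^ 2 := by gcongr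
    _ = (M * m ^ 2 + s) ^ 2 := by ring

theorem noiseOp_cons {X : Type*} [Fintype X] [DecidableEq X] {N : ℕ} (ρ : ℝ)
    (F : (Fin (N + 1) → X) → ℝ) (a : X) (x : Fin N → X) :
    noiseOp ρ F (Fin.cons a x) =
      (noiseMatrix X ρ).mulVec (fun b => noiseOp ρ (fun y => F (Fin.cons b y)) x) a := by
  simp only [noiseOp, Matrix.mulVec, dotProduct, tensorMatrix, Matrix.of_apply]
  rw [← (Fin.consEquiv fun _ => X).sum_comp, Fintype.sum_prod_type]
  refine Finset.sum_congr rfl fun b _ => ?_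
  rw [Finset.mul_sum]
  refine Finset.sum_congr rfl fun y _ => ?_
  simp [Fin.consEquiv, Fin.prod_univ_succ, mul_assoc]

/-- The hypercontractive inequality `‖T F‖₄ ≤ ‖F‖₂` tensorizes to any number of coordinates. -/
theorem sum_noiseOp_pow_four_le {X : Type*} [Fintype X] [DecidableEq X] [Nonempty X] {ρ : ℝ}
    (h1 : 4 * ρ ^ 2 ≤ 1) (h2 : 3 * ρ ^ 4 * Fintype.card X ≤ 1) {N : ℕ} (F : (Fin N → X) → ℝ) :
    (Fintype.card X : ℝ) ^ N * ∑ x, noiseOp ρ F x ^ 4 ≤ (∑ x, F x ^ 2) ^ 2 := by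
  induction N with
  | zero =>
    simp [noiseOp, tensorMatrix, Matrix.mulVec, dotProduct, ← pow_mul]
  | succ N ih =>
    set M : ℝ := (Fintype.card X : ℝ) with hM
    have hM0 : 0 ≤ M := Nat.cast_nonneg _
    set v : X → (Fin N → X) → ℝ := fun b => noiseOp ρ fun y => F (Fin.cons b y) with hv
    have hs : ∀ G : (Fin (N + 1) → X) → ℝ, ∑ x, G x = ∑ a, ∑ x, G (Fin.cons a x) := fun G => by
      rw [← (Fin.consEquiv fun _ => X).sum_comp, Fintype.sum_prod_type]
      rfl
    -- Cauchy-Schwarz in the last `N` coordinates and the induction hypothesis for both factors.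
    have hcs : ∀ b b', M ^ N * ∑ x, v b x ^ 2 * v b' x ^ 2 ≤
        (∑ x, F (Fin.cons b x) ^ 2) * ∑ x, F (Fin.cons b' x) ^ 2 := fun b b' => by
      have hc := Finset.sum_mul_sq_le_sq_mul_sq Finset.univ (fun x => v b x ^ 2)
        fun x => v b' x ^ 2
      simp only [← pow_mul] at hc
      refine le_of_sq_le_sq ?_ (by positivity)
      calc (M ^ N * ∑ x, v b x ^ 2 * v b' x ^ 2) ^ 2
          = M ^ N * M ^ N * (∑ x, v b x ^ 2 * v b' x ^ 2) ^ 2 := by ring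
        _ ≤ M ^ N * M ^ N * ((∑ x, v b x ^ 4) * ∑ x, v b' x ^ 4) := by gcongr
        _ = (M ^ N * ∑ x, v b x ^ 4) * (M ^ N * ∑ x, v b' x ^ 4) := by ring
        _ ≤ (∑ x, F (Fin.cons b x) ^ 2) ^ 2 * (∑ x, F (Fin.cons b' x) ^ 2) ^ 2 := by
          gcongr
          · exact ih _
          · exact ih _
        _ = _ := by ring
    calc M ^ (N + 1) * ∑ x, noiseOp ρ F x ^ 4
        = M ^ N * ∑ x, (M * ∑ a, (noiseMatrix X ρ).mulVec (fun b => v b x) a ^ 4) := by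
          rw [hs, Finset.sum_comm, ← Finset.mul_sum, pow_succ, mul_assoc]
          simp only [noiseOp_cons, hv]
      _ ≤ M ^ N * ∑ x, (∑ b, v b x ^ 2) ^ 2 := by
          gcongr with x
          exact sum_noiseMatrix_pow_four_le h1 h2 _
      _ = ∑ b, ∑ b', M ^ N * ∑ x, v b x ^ 2 * v b' x ^ 2 := by
          rw [Finset.mul_sum]
          have : ∀ x, M ^ N * (∑ b, v b x ^ 2) ^ 2 = ∑ b, ∑ b', M ^ N * (v b x ^ 2 * v b' x ^ 2) :=
            fun x => by
              rw [sq (∑ b, v b x ^ 2), Finset.sum_mul_sum]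
              simp only [Finset.mul_sum]
          simp only [this, Finset.mul_sum]
          rw [Finset.sum_comm]
          exact Finset.sum_congr rfl fun b _ => Finset.sum_comm
      _ ≤ ∑ b, ∑ b', (∑ x, F (Fin.cons b x) ^ 2) * ∑ x, F (Fin.cons b' x) ^ 2 :=
          Finset.sum_le_sum fun b _ => Finset.sum_le_sum fun b' _ => hcs b b'
      _ = (∑ x, F x ^ 2) ^ 2 := by
          rw [hs, sq, Finset.sum_mul_sum]


/-- The form of Hölder's inequality needed for duality, from Cauchy-Schwarz applied twice. -/
theorem sum_abs_mul_abs_pow_four_le {Y : Type*} [Fintype Y] {G : Y → ℝ} (hG : ∀ x, |G x| ≤ 1)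
    (H : Y → ℝ) :
    (∑ x, |G x| * |H x|) ^ 4 ≤ (∑ x, |G x|) ^ 3 * ∑ x, H x ^ 4 := by
  have key : ∀ K : Y → ℝ, (∑ x, |G x| * K x) ^ 2 ≤ (∑ x, |G x|) * ∑ x, |G x| * K x ^ 2 := fun K =>
    Finset.sum_sq_le_sum_mul_sum_of_sq_le_mul _ (fun _ _ => abs_nonneg _)
      (fun _ _ => mul_nonneg (abs_nonneg _) (sq_nonneg _)) fun _ _ => le_of_eq (by ring)
  have h0 : 0 ≤ ∑ x, |G x| := Finset.sum_nonneg fun _ _ => abs_nonneg _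
  have h1 := key fun x => |H x|
  have h2 := key fun x => H x ^ 2
  simp only [sq_abs, ← pow_mul] at h1 h2
  calc (∑ x, |G x| * |H x|) ^ 4 = ((∑ x, |G x| * |H x|) ^ 2) ^ 2 := by ring
    _ ≤ ((∑ x, |G x|) * ∑ x, |G x| * H x ^ 2) ^ 2 := by gcongr
    _ = (∑ x, |G x|) ^ 2 * (∑ x, |G x| * H x ^ 2) ^ 2 := by ring
    _ ≤ (∑ x, |G x|) ^ 2 * ((∑ x, |G x|) * ∑ x, |G x| * H x ^ 4) := by gcongr
    _ ≤ (∑ x, |G x|) ^ 2 * ((∑ x, |G x|) * ∑ x, 1 * H x ^ 4) := by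
        gcongr with x
        exact hG x
    _ = _ := by simp only [one_mul]; ring

/-- Dual form of the hypercontractive inequality: for `|G| ≤ 1` the mean square of the noisy version
of `G` is at most the power `3 / 2` of the mean of `|G|`. -/
theorem sq_sum_noiseOp_sq_le {X : Type*} [Fintype X] [DecidableEq X] [Nonempty X] {ρ : ℝ}
    (h1 : 4 * ρ ^ 2 ≤ 1) (h2 : 3 * ρ ^ 4 * Fintype.card X ≤ 1) {N : ℕ} {G : (Fin N → X) → ℝ}
    (hG : ∀ x, |G x| ≤ 1) :
    (Fintype.card X : ℝ) ^ N * (noiseOp ρ G ⬝ᵥ noiseOp ρ G) ^ 2 ≤ (∑ x, |G x|) ^ 3 := by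
  set A := noiseOp ρ G ⬝ᵥ noiseOp ρ G with hA
  have hA2 : A = ∑ x, noiseOp ρ G x ^ 2 := Finset.sum_congr rfl fun x _ => (sq _).symm
  have hA0 : 0 ≤ A := hA2 ▸ Finset.sum_nonneg fun _ _ => sq_nonneg _
  have hsymm : A = G ⬝ᵥ noiseOp ρ (noiseOp ρ G) := by
    have ht : (noiseMatrix X ρ).transpose = noiseMatrix X ρ := by
      simp [noiseMatrix, averagingMatrix_transpose]
    rw [hA, noiseOp, mulVec_dotProduct_mulVec, tensorMatrix_transpose, noiseOp,
      Matrix.mulVec_mulVec, ht]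
  have hle : A ≤ ∑ x, |G x| * |noiseOp ρ (noiseOp ρ G) x| := by
    rw [hsymm]
    exact Finset.sum_le_sum fun x _ => (le_abs_self _).trans (abs_mul _ _).le
  have h0 : 0 ≤ ∑ x, |G x| := Finset.sum_nonneg fun _ _ => abs_nonneg _
  have h4 := sum_noiseOp_pow_four_le h1 h2 (noiseOp ρ G)
  rw [← hA2] at h4
  rcases hA0.eq_or_lt with h | h
  · rw [← h]
    simpa using pow_nonneg h0 3
  · refine le_of_mul_le_mul_right ?_ (pow_pos h 2)
    calc (Fintype.card X : ℝ) ^ N * A ^ 2 * A ^ 2 = (Fintype.card X : ℝ) ^ N * A ^ 4 := by ring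
      _ ≤ (Fintype.card X : ℝ) ^ N * (∑ x, |G x| * |noiseOp ρ (noiseOp ρ G) x|) ^ 4 := by gcongr
      _ ≤ (Fintype.card X : ℝ) ^ N *
          ((∑ x, |G x|) ^ 3 * ∑ x, noiseOp ρ (noiseOp ρ G) x ^ 4) := by
        gcongr
        exact sum_abs_mul_abs_pow_four_le hG _
      _ = (∑ x, |G x|) ^ 3 *
          ((Fintype.card X : ℝ) ^ N * ∑ x, noiseOp ρ (noiseOp ρ G) x ^ 4) := by ring
      _ ≤ (∑ x, |G x|) ^ 3 * A ^ 2 := by gcongr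

/-! ### Juntas on a finite product space -/

/-- **Friedgut's junta theorem** for bounded functions on a power of a finite uniform probability
space: if the total influence is at most one, then the function is close in mean square to its
average over all but a bounded number of coordinates, namely those of non-negligible influence. -/
theorem exists_averageOutside_close (X : Type*) [Fintype X] [DecidableEq X] [Nonempty X] {η : ℝ}
    (hη : 0 < η) :
    ∃ q : ℕ, ∀ (N : ℕ) (F : (Fin N → X) → ℝ), (∀ n x, |coordLaplacian n F x| ≤ 1) →
      ∑ n, ∑ x, |coordLaplacian n F x| ≤ (Fintype.card X : ℝ) ^ N →
        ∃ S : Finset (Fin N), S.card ≤ q ∧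
          ∑ x, (F x - averageOutside S F x) ^ 2 ≤ η * (Fintype.card X : ℝ) ^ N := by
  set M : ℝ := (Fintype.card X : ℝ) with hM
  have hM1 : 1 ≤ M := Nat.one_le_cast.2 Fintype.card_pos
  have hM0 : 0 < M := by linarith
  obtain ⟨ρ, hρ⟩ : ∃ ρ : ℝ, ρ = (2 * M)⁻¹ := ⟨_, rfl⟩
  have hρ0 : 0 < ρ := by rw [hρ]; positivity
  have hρM : ρ * M = 1 / 2 := by rw [hρ]; field_simp
  have hρ1 : ρ ≤ 1 / 2 := hρM ▸ le_mul_of_one_le_right hρ0.le hM1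
  have h1 : 4 * ρ ^ 2 ≤ 1 := by nlinarith
  have h2 : 3 * ρ ^ 4 * M ≤ 1 := by
    have h3 : ρ ^ 3 ≤ (1 / 2) ^ 3 := by gcongr
    calc 3 * ρ ^ 4 * M = 3 * ρ ^ 3 * (ρ * M) := by ring
      _ ≤ 1 := by rw [hρM]; linarith
  obtain ⟨d, hd⟩ := exists_nat_gt (2 / η)
  have hd0 : (0 : ℝ) < d := lt_trans (by positivity) hd
  have hdη : 1 / (d : ℝ) ≤ η / 2 := by
    rw [div_le_div_iff₀ hd0 two_pos]
    rw [div_lt_iff₀ hη] at hd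
    linarith
  obtain ⟨τ, hτ⟩ : ∃ τ : ℝ, τ = ρ ^ (2 * d) * (η / 2) := ⟨_, rfl⟩
  have hτ0 : 0 < τ := by rw [hτ]; positivity
  obtain ⟨q, hq⟩ := exists_nat_gt (1 / τ ^ 2)
  refine ⟨q, fun N F hF hI => ?_⟩
  have hMN : 0 < M ^ N := pow_pos hM0 N
  set a : Fin N → ℝ := fun n => ∑ x, |coordLaplacian n F x| with ha
  have ha0 : ∀ n, 0 ≤ a n := fun n => Finset.sum_nonneg fun _ _ => abs_nonneg _
  set S : Finset (Fin N) := Finset.univ.filter fun n => τ ^ 2 * M ^ N ≤ a n with hS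
  refine ⟨S, ?_, ?_⟩
  · have : S.card • (τ ^ 2 * M ^ N) ≤ M ^ N :=
      (Finset.card_nsmul_le_sum S a _ fun n hn => (Finset.mem_filter.1 hn).2).trans
        ((Finset.sum_le_univ_sum_of_nonneg ha0).trans hI)
    rw [nsmul_eq_mul, ← mul_assoc, mul_le_iff_le_one_left hMN, ← le_div_iff₀ (by positivity)] at this
    exact_mod_cast this.trans hq.le
  · -- The total spectral weight, counted with multiplicity the size of the set.
    have hw := spectralWeight_nonneg F
    have hdeg : ∑ A : Finset (Fin N), (A.card : ℝ) * spectralWeight F A ≤ M ^ N := by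
      calc ∑ A : Finset (Fin N), (A.card : ℝ) * spectralWeight F A
          = ∑ n, ∑ x, coordLaplacian n F x ^ 2 := by
            simp only [sum_sq_coordLaplacian]
            rw [Finset.sum_comm]
            refine Finset.sum_congr rfl fun A _ => ?_
            rw [← Finset.sum_mul]
            simp
        _ ≤ ∑ n, a n := by
            refine Finset.sum_le_sum fun n _ => Finset.sum_le_sum fun x _ => ?_
            rw [← sq_abs]
            nlinarith [abs_nonneg (coordLaplacian n F x), hF n x]
        _ ≤ M ^ N := hI
    -- The weight of low degree, damped by the noise, outside the influential coordinates.
    have hlow : ∑ n ∈ Sᶜ, ∑ A : Finset (Fin N),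
        (if n ∈ A then ρ ^ (2 * A.card) else 0) * spectralWeight F A ≤ τ * M ^ N := by
      calc ∑ n ∈ Sᶜ, ∑ A : Finset (Fin N),
            (if n ∈ A then ρ ^ (2 * A.card) else 0) * spectralWeight F A
          = ∑ n ∈ Sᶜ, noiseOp ρ (coordLaplacian n F) ⬝ᵥ noiseOp ρ (coordLaplacian n F) := by
            simp only [noiseOp_coordLaplacian_dotProduct]
        _ ≤ ∑ n ∈ Sᶜ, τ * a n := by
            refine Finset.sum_le_sum fun n hn => ?_
            have hn' : a n < τ ^ 2 * M ^ N := by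
              simpa [hS] using hn
            have h3 := sq_sum_noiseOp_sq_le h1 h2 (hF n)
            refine le_of_sq_le_sq (le_of_mul_le_mul_left (h3.trans ?_) hMN)
              (mul_nonneg hτ0.le (ha0 n))
            calc a n ^ 3 = a n * a n ^ 2 := by ring
              _ ≤ τ ^ 2 * M ^ N * a n ^ 2 := by gcongr
              _ = M ^ N * (τ * a n) ^ 2 := by ring
        _ = τ * ∑ n ∈ Sᶜ, a n := by rw [Finset.mul_sum]
        _ ≤ τ * M ^ N := by
            gcongr
            exact (Finset.sum_le_univ_sum_of_nonneg ha0).trans hI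
    rw [sum_sq_sub_averageOutside]
    -- A set not contained in `S` is either large, or small and meets the complement of `S`.
    have hpt : ∀ A : Finset (Fin N), (if A ⊆ S then (0 : ℝ) else 1) ≤
        1 / d * A.card + (ρ ^ (2 * d))⁻¹ *
          ∑ n ∈ Sᶜ, if n ∈ A then ρ ^ (2 * A.card) else 0 := fun A => by
      have hs0 : 0 ≤ ∑ n ∈ Sᶜ, if n ∈ A then ρ ^ (2 * A.card) else 0 :=
        Finset.sum_nonneg fun n _ => by split_ifs <;> positivity
      split_ifs with hAS
      · positivity
      · obtain ⟨n, hnA, hnS⟩ := Finset.not_subset.1 hAS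
        rcases le_total d A.card with hdA | hdA
        · have : (1 : ℝ) ≤ 1 / d * A.card := by
            rw [one_div, inv_mul_eq_div, le_div_iff₀ hd0, one_mul]
            exact_mod_cast hdA
          have : 0 ≤ (ρ ^ (2 * d))⁻¹ * ∑ n ∈ Sᶜ, if n ∈ A then ρ ^ (2 * A.card) else 0 := by
            positivity
          linarith
        · have h3 : ρ ^ (2 * d) ≤ ∑ n ∈ Sᶜ, if n ∈ A then ρ ^ (2 * A.card) else 0 :=
            calc ρ ^ (2 * d) ≤ ρ ^ (2 * A.card) :=
                  pow_le_pow_of_le_one hρ0.le (by linarith) (by omega)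
              _ = if n ∈ A then ρ ^ (2 * A.card) else 0 := (if_pos hnA).symm
              _ ≤ _ := Finset.single_le_sum
                  (f := fun n => if n ∈ A then ρ ^ (2 * A.card) else 0)
                  (fun m _ => by split_ifs <;> positivity) (Finset.mem_compl.2 hnS)
          have h4 : (1 : ℝ) ≤ (ρ ^ (2 * d))⁻¹ *
              ∑ n ∈ Sᶜ, if n ∈ A then ρ ^ (2 * A.card) else 0 := by
            rw [inv_mul_eq_div, le_div_iff₀ (by positivity), one_mul]
            exact h3
          have : 0 ≤ 1 / (d : ℝ) * A.card := by positivity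
          linarith
    calc ∑ A : Finset (Fin N), (if A ⊆ S then 0 else 1) * spectralWeight F A
        ≤ ∑ A : Finset (Fin N), (1 / d * A.card + (ρ ^ (2 * d))⁻¹ *
            ∑ n ∈ Sᶜ, if n ∈ A then ρ ^ (2 * A.card) else 0) * spectralWeight F A :=
          Finset.sum_le_sum fun A _ => mul_le_mul_of_nonneg_right (hpt A) (hw A)
      _ = 1 / d * (∑ A : Finset (Fin N), (A.card : ℝ) * spectralWeight F A) +
          (ρ ^ (2 * d))⁻¹ * ∑ n ∈ Sᶜ, ∑ A : Finset (Fin N),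
            (if n ∈ A then ρ ^ (2 * A.card) else 0) * spectralWeight F A := by
          rw [Finset.sum_comm (s := Sᶜ), Finset.mul_sum, Finset.mul_sum, ← Finset.sum_add_distrib]
          refine Finset.sum_congr rfl fun A _ => ?_
          rw [← Finset.sum_mul]
          ring
      _ ≤ η / 2 * M ^ N + (ρ ^ (2 * d))⁻¹ * (τ * M ^ N) :=
          add_le_add ((mul_le_mul_of_nonneg_left hdeg (by positivity)).trans
            (mul_le_mul_of_nonneg_right hdη hMN.le))
            (mul_le_mul_of_nonneg_left hlow (by positivity))
      _ = η * M ^ N := by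
          rw [hτ, mul_assoc (ρ ^ (2 * d)), inv_mul_cancel_left₀ (pow_pos hρ0 _).ne']
          ring

/-! ### Coordinate increments of a Lipschitz function on the torus -/

/-- The dual norm of the supremum norm is the `ℓ¹` norm. -/
theorem sum_abs_apply_single_le {N : ℕ} (L : (Fin N → ℝ) →L[ℝ] ℝ) (h : Fin N → ℝ) :
    ∑ n, |L (Pi.single n (h n))| ≤ ‖L‖ * ‖h‖ := by
  set σ : Fin N → ℝ := fun n => SignType.sign (L (Pi.single n (h n))) with hσ
  have h1 : ∑ n, |L (Pi.single n (h n))| = L fun n => σ n * h n := by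
    calc ∑ n, |L (Pi.single n (h n))| = ∑ n, σ n * L (Pi.single n (h n)) :=
          Finset.sum_congr rfl fun n _ => (sign_mul_self _).symm
      _ = ∑ n, L (Pi.single n (σ n * h n)) := by
          refine Finset.sum_congr rfl fun n _ => ?_
          rw [← smul_eq_mul, ← map_smul, ← Pi.single_smul, smul_eq_mul]
      _ = L fun n => σ n * h n := by
          rw [← map_sum, Finset.univ_sum_single]
  rw [h1]
  refine ((le_abs_self _).trans (L.le_opNorm _)).trans ?_
  gcongr
  refine (pi_norm_le_iff_of_nonneg (norm_nonneg _)).2 fun n => ?_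
  have : ‖σ n‖ ≤ 1 := by
    simp only [hσ]
    rcases SignType.sign (L (Pi.single n (h n))) <;> simp
  rw [norm_mul]
  calc ‖σ n‖ * ‖h n‖ ≤ 1 * ‖h‖ := by gcongr; exact norm_le_pi_norm h n
    _ = ‖h‖ := one_mul _

theorem lipschitzWith_coe_unitAddCircle : LipschitzWith 1 ((↑) : ℝ → UnitAddCircle) := by
  refine LipschitzWith.of_dist_le_mul fun x y => ?_
  rw [NNReal.coe_one, one_mul, dist_eq_norm, dist_eq_norm, ← AddCircle.coe_sub]
  exact QuotientAddGroup.norm_mk_le_norm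

instance : IsProbabilityMeasure (volume : Measure UnitAddCircle) :=
  ⟨UnitAddCircle.measure_univ⟩

/-- By translation invariance, the mean absolute increment is subadditive in the displacement. -/
theorem integral_abs_increment_le {N : ℕ} {f : (Fin N → UnitAddCircle) → ℝ} (hf : Continuous f)
    (v : Fin N → UnitAddCircle) (k : ℕ) :
    ∫ x, |f (x + k • v) - f x| ≤ k * ∫ x, |f (x + v) - f x| := by
  have hint : ∀ g : (Fin N → UnitAddCircle) → ℝ, Continuous g → Integrable g := fun g hg =>
    hg.integrable_of_hasCompactSupport (HasCompactSupport.of_compactSpace g)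
  induction k with
  | zero => simp
  | succ k ih =>
    calc ∫ x, |f (x + (k + 1) • v) - f x|
        ≤ ∫ x, (|f (x + k • v + v) - f (x + k • v)| + |f (x + k • v) - f x|) := by
          refine integral_mono (hint _ (by fun_prop)) (hint _ (by fun_prop)) fun x => ?_
          simp only [succ_nsmul, ← add_assoc]
          exact abs_sub_le _ _ _
      _ = (∫ x, |f (x + v) - f x|) + ∫ x, |f (x + k • v) - f x| := by
          rw [integral_add (hint _ (by fun_prop)) (hint _ (by fun_prop)),
            integral_add_right_eq_self (fun x => |f (x + v) - f x|) (k • v)]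
      _ ≤ (k + 1 : ℕ) * ∫ x, |f (x + v) - f x| := by
          push_cast
          linarith

open Filter Topology in
/-- The mean absolute increments of a Lipschitz function under displacements of single coordinates
have a sum bounded independently of the number of coordinates. By subadditivity the displacements
may be taken infinitesimal, where by Rademacher's theorem the increments are partial derivatives,
whose absolute values have sum at most `1`. -/
theorem sum_integral_abs_increment_le {N : ℕ} {f : (Fin N → UnitAddCircle) → ℝ}
    (hf : LipschitzWith 1 f) (h : Fin N → ℝ) :
    ∑ n, ∫ x, |f (x + Pi.single n (h n : UnitAddCircle)) - f x| ≤ ‖h‖ := by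
  set π : (Fin N → ℝ) → Fin N → UnitAddCircle := fun x n => (x n : UnitAddCircle) with hπ
  set g : (Fin N → ℝ) → ℝ := f ∘ π with hg
  have hπL : LipschitzWith 1 π := LipschitzWith.of_dist_le_mul fun x y => by
    rw [NNReal.coe_one, one_mul]
    refine (dist_pi_le_iff dist_nonneg).2 fun n => ?_
    have := lipschitzWith_coe_unitAddCircle.dist_le_mul (x n) (y n)
    rw [NNReal.coe_one, one_mul] at this
    exact this.trans (dist_le_pi_dist x y n)
  have hgL : LipschitzWith 1 g := by simpa using hf.comp hπL
  set ν : Measure (Fin N → ℝ) := Measure.pi fun _ => volume.restrict (Set.Ioc 0 (0 + 1)) with hν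
  have hπm : MeasurePreserving π ν volume :=
    measurePreserving_pi _ _ fun _ => UnitAddCircle.measurePreserving_mk 0
  have hνp : IsProbabilityMeasure ν := by
    refine ⟨?_⟩
    rw [← Set.preimage_univ (f := π), hπm.measure_preimage MeasurableSet.univ.nullMeasurableSet]
    exact measure_univ
  have hdiff : ∀ᵐ x ∂ν, DifferentiableAt ℝ g x := by
    rw [hν, ← Measure.restrict_pi_pi]
    exact ae_restrict_of_ae hgL.ae_differentiableAt
  have hint : ∀ u : (Fin N → UnitAddCircle) → ℝ, Continuous u → Integrable u := fun u hu =>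
    hu.integrable_of_hasCompactSupport (HasCompactSupport.of_compactSpace u)
  have hgc := hgL.continuous
  -- The difference quotients along the coordinate displacements `h n / (k + 1)`.
  set Φ : ℕ → (Fin N → ℝ) → ℝ := fun k x =>
    ∑ n, |((k : ℝ) + 1) • (g (x + ((k : ℝ) + 1)⁻¹ • Pi.single n (h n)) - g x)| with hΦ
  have hlim : Tendsto (fun k => ∫ x, Φ k x ∂ν) atTop
      (𝓝 (∫ x, ∑ n, |fderiv ℝ g x (Pi.single n (h n))| ∂ν)) := by
    refine tendsto_integral_of_dominated_convergence (fun _ => ∑ n, |h n|) (fun k => ?_)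
      (integrable_const _) (fun k => ?_) ?_
    · exact Continuous.aestronglyMeasurable (by fun_prop)
    · refine Eventually.of_forall fun x => ?_
      rw [Real.norm_of_nonneg (Finset.sum_nonneg fun _ _ => abs_nonneg _)]
      refine Finset.sum_le_sum fun n _ => ?_
      have hk : (0 : ℝ) < (k : ℝ) + 1 := by positivity
      have := hgL.dist_le_mul (x + ((k : ℝ) + 1)⁻¹ • Pi.single n (h n)) x
      rw [Real.dist_eq, dist_self_add_left, norm_smul, Pi.norm_single, norm_inv,
        Real.norm_of_nonneg hk.le, NNReal.coe_one, one_mul, inv_mul_eq_div, le_div_iff₀ hk,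
        Real.norm_eq_abs] at this
      rwa [smul_eq_mul, abs_mul, abs_of_pos hk, mul_comm]
    · filter_upwards [hdiff] with x hx
      refine tendsto_finsetSum _ fun n _ => (Tendsto.abs ?_)
      refine hx.hasFDerivAt.lim _ ?_
      refine tendsto_norm_atTop_atTop.comp ?_
      exact tendsto_atTop_add_const_right _ _ tendsto_natCast_atTop_atTop
  have hbound : ∫ x, ∑ n, |fderiv ℝ g x (Pi.single n (h n))| ∂ν ≤ ‖h‖ := by
    calc ∫ x, ∑ n, |fderiv ℝ g x (Pi.single n (h n))| ∂ν ≤ ∫ _, ‖h‖ ∂ν := by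
          refine integral_mono_of_nonneg
            (Eventually.of_forall fun x => Finset.sum_nonneg fun _ _ => abs_nonneg _)
            (integrable_const _) (Eventually.of_forall fun x => ?_)
          refine (sum_abs_apply_single_le _ _).trans ?_
          have : ‖fderiv ℝ g x‖ ≤ 1 := by simpa using norm_fderiv_le_of_lipschitz ℝ hgL
          exact mul_le_of_le_one_left (norm_nonneg _) this
      _ = ‖h‖ := by simp
  refine (ge_of_tendsto' hlim fun k => ?_).trans hbound
  have hk : (0 : ℝ) < (k : ℝ) + 1 := by positivity
  set v : Fin N → Fin N → UnitAddCircle := fun n =>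
    Pi.single n ((((k : ℝ) + 1)⁻¹ * h n : ℝ) : UnitAddCircle) with hv
  have hkv : ∀ n, (k + 1) • v n = Pi.single n (h n : UnitAddCircle) := fun n => by
    rw [hv, ← Pi.single_smul, ← AddCircle.coe_nsmul, nsmul_eq_mul, Nat.cast_add_one,
      mul_inv_cancel_left₀ hk.ne']
  have hπv : ∀ n x, π (x + ((k : ℝ) + 1)⁻¹ • Pi.single n (h n)) = π x + v n := fun n x => by
    funext m
    by_cases hm : m = n
    · subst hm
      simp [hπ, hv]
    · simp [hπ, hv, hm]
  have hcont := hf.continuous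
  calc ∑ n, ∫ x, |f (x + Pi.single n (h n : UnitAddCircle)) - f x|
      ≤ ∑ n, ((k : ℝ) + 1) * ∫ x, |f (x + v n) - f x| := by
        refine Finset.sum_le_sum fun n _ => ?_
        rw [← hkv]
        simpa using integral_abs_increment_le hcont (v n) (k + 1)
    _ = ∫ y, ∑ n, ((k : ℝ) + 1) * |f (y + v n) - f y| := by
        rw [integral_finsetSum _ fun n _ => hint _ (by fun_prop)]
        simp only [integral_const_mul]
    _ = ∫ x, Φ k x ∂ν := by
        rw [← hπm.map_eq, integral_map hπm.measurable.aemeasurable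
          (Continuous.aestronglyMeasurable (by fun_prop))]
        refine integral_congr_ae (Eventually.of_forall fun x => ?_)
        simp only [hΦ, hg, Function.comp_apply, hπv, smul_eq_mul, abs_mul, abs_of_pos hk]

/-- The total influence of a Lipschitz function sampled on a translated grid is bounded, for a
suitable translation. A translation has to be chosen because the bound holds only on average: on
one given grid, the function may fluctuate on the scale of the mesh in every coordinate. -/
theorem exists_translate_sum_coordLaplacian_le {X : Type*} [Fintype X] [DecidableEq X] [Nonempty X]
    {p : X → ℝ} (hp : ∀ i j, |p i - p j| ≤ 1) {N : ℕ} {f : (Fin N → UnitAddCircle) → ℝ}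
    (hf : LipschitzWith 1 f) :
    ∃ u : Fin N → UnitAddCircle,
      ∑ n, ∑ c, |coordLaplacian n (fun c : Fin N → X => f fun m => u m + p (c m)) c| ≤
        (Fintype.card X : ℝ) ^ N := by
  have hM : (0 : ℝ) < Fintype.card X := by exact_mod_cast Fintype.card_pos
  have hcont := hf.continuous
  have hint : ∀ u : (Fin N → UnitAddCircle) → ℝ, Continuous u → Integrable u := fun u hu =>
    hu.integrable_of_hasCompactSupport (HasCompactSupport.of_compactSpace u)
  set q : (Fin N → X) → Fin N → UnitAddCircle := fun c m => p (c m) with hq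
  set G : (Fin N → X) → X → Fin N → (Fin N → UnitAddCircle) → ℝ := fun c j n u =>
    |f (u + q (Function.update c n j)) - f (u + q c)| with hG
  have hGi : ∀ c j n, Integrable (G c j n) := fun c j n => hint _ (by fun_prop)
  have hGs : ∀ c j, Integrable fun u => ∑ n, G c j n u := fun c j =>
    integrable_finsetSum _ fun n _ => hGi c j n
  have hGt : ∀ c, Integrable fun u => (∑ j, ∑ n, G c j n u) / Fintype.card X := fun c =>
    (integrable_finsetSum _ fun j _ => hGs c j).div_const _
  have hqu : ∀ c n j, q (Function.update c n j) =
      q c + Pi.single n ((p j - p (c n) : ℝ) : UnitAddCircle) := fun c n j => by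
    funext m
    by_cases hm : m = n
    · subst hm
      simp [hq]
    · simp [hq, hm]
  have h1 : ∀ c j, ∫ u, ∑ n, G c j n u ≤ 1 := fun c j => by
    rw [integral_finsetSum _ fun n _ => hGi c j n]
    obtain ⟨h, hh⟩ : ∃ h : Fin N → ℝ, h = fun n => p j - p (c n) := ⟨_, rfl⟩
    have hle : ‖h‖ ≤ 1 := (pi_norm_le_iff_of_nonneg zero_le_one).2 fun n => by
      rw [hh]
      exact hp _ _
    refine le_trans (Finset.sum_le_sum fun n _ => le_of_eq ?_)
      ((sum_integral_abs_increment_le hf h).trans hle)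
    have := integral_add_right_eq_self (μ := volume) (fun x : Fin N → UnitAddCircle =>
      |f (x + (Pi.single n (h n : UnitAddCircle) : Fin N → UnitAddCircle)) - f x|) (q c)
    rw [← this]
    simp only [hG, hqu, hh, add_assoc]
  have hint : ∫ u, ∑ c, (∑ j, ∑ n, G c j n u) / Fintype.card X ≤ (Fintype.card X : ℝ) ^ N := by
    calc ∫ u, ∑ c, (∑ j, ∑ n, G c j n u) / Fintype.card X
        = ∑ c, (∑ j, ∫ u, ∑ n, G c j n u) / Fintype.card X := by
          rw [integral_finsetSum _ fun c _ => hGt c]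
          refine Finset.sum_congr rfl fun c _ => ?_
          rw [integral_div, integral_finsetSum _ fun j _ => hGs c j]
      _ ≤ ∑ _c : Fin N → X, (∑ _j : X, (1 : ℝ)) / Fintype.card X :=
          Finset.sum_le_sum fun c _ => div_le_div_of_nonneg_right
            (Finset.sum_le_sum fun j _ => h1 c j) hM.le
      _ = (Fintype.card X : ℝ) ^ N := by
          simp [hM.ne']
  have hGD : Integrable fun u => ∑ c, (∑ j, ∑ n, G c j n u) / Fintype.card X :=
    integrable_finsetSum _ fun c _ => hGt c
  obtain ⟨u, hu⟩ := exists_le_integral hGD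
  refine ⟨u, le_trans ?_ (hu.trans hint)⟩
  rw [Finset.sum_comm]
  refine Finset.sum_le_sum fun c _ => ?_
  rw [Finset.sum_comm, Finset.sum_div]
  exact Finset.sum_le_sum fun n _ => abs_coordLaplacian_le n _ c

/-! ### Transfer from a finite grid to the torus -/

theorem integrateOut_uniform {X : Type*} [Fintype X] [Nonempty X] [DecidableEq X]
    [MeasurableSpace X] [MeasurableSingletonClass X] {N : ℕ} (n : Fin N) (F : (Fin N → X) → ℝ) :
    integrateOut (PMF.uniformOfFintype X).toMeasure n F =
      (tensorMatrix fun m => if m = n then averagingMatrix X else 1).mulVec F := by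
  funext x
  rw [tensorMatrix_ite_mulVec, integrateOut, PMF.integral_eq_sum]
  simp [averagingMatrix]

theorem condExpOn_uniform {X : Type*} [Fintype X] [Nonempty X] [DecidableEq X]
    [MeasurableSpace X] [MeasurableSingletonClass X] {N : ℕ} (S : Finset (Fin N))
    (F : (Fin N → X) → ℝ) :
    condExpOn (PMF.uniformOfFintype X).toMeasure S F = averageOutside S F := by
  have key : ∀ l : List (Fin N), l.foldr (integrateOut (PMF.uniformOfFintype X).toMeasure) F =
      (tensorMatrix fun n => if n ∈ l then averagingMatrix X else 1).mulVec F := fun l => by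
    induction l with
    | nil =>
      simp only [List.foldr_nil, List.not_mem_nil, if_false]
      rw [show (fun _ : Fin N => (1 : Matrix X X ℝ)) = 1 from rfl, tensorMatrix_one,
        Matrix.one_mulVec]
    | cons n l ih =>
      rw [List.foldr_cons, ih, integrateOut_uniform, Matrix.mulVec_mulVec, tensorMatrix_mul]
      congr 2
      funext m
      rcases eq_or_ne m n with rfl | h1
      · by_cases h2 : m ∈ l <;> simp [h2, averagingMatrix_mul_self]
      · by_cases h2 : m ∈ l <;> simp [h1, h2]
  rw [condExpOn, key, averageOutside]
  congr 2
  funext n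
  by_cases h : n ∈ S <;> simp [h]

/-- Integrating out a coordinate commutes with a measure preserving map acting on each
coordinate. -/
theorem integrateOut_comp {X Y : Type*} [MeasurableSpace X] [MeasurableSpace Y] {μ : Measure X}
    {ν : Measure Y} [Countable X] [MeasurableSingletonClass X] {N : ℕ} {r : Fin N → Y → X}
    (hr : ∀ n, MeasurePreserving (r n) ν μ) (n : Fin N) (G : (Fin N → X) → ℝ) (y : Fin N → Y) :
    integrateOut ν n (fun z => G fun m => r m (z m)) y =
      integrateOut μ n G fun m => r m (y m) := by
  simp only [integrateOut]
  rw [← (hr n).map_eq, integral_map (hr n).measurable.aemeasurable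
    (measurable_of_countable _).aestronglyMeasurable]
  refine integral_congr_ae (Filter.Eventually.of_forall fun t => ?_)
  dsimp only
  congr 1
  funext m
  by_cases hm : m = n
  · subst hm
    simp
  · simp [hm]

theorem LipschitzWith.integrable_update {Y : Type*} [MetricSpace Y] [CompactSpace Y]
    [MeasurableSpace Y] [BorelSpace Y] {ν : Measure Y} [IsFiniteMeasure ν] {N : ℕ}
    {f : (Fin N → Y) → ℝ} (hf : LipschitzWith 1 f) (n : Fin N) (x : Fin N → Y) :
    Integrable (fun y => f (Function.update x n y)) ν := by
  have hc := hf.continuous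
  exact (hc.comp (continuous_const.update n continuous_id)).integrable_of_hasCompactSupport
    (HasCompactSupport.of_compactSpace _)

theorem LipschitzWith.integrateOut {Y : Type*} [MetricSpace Y] [CompactSpace Y]
    [MeasurableSpace Y] [BorelSpace Y] {ν : Measure Y} [IsProbabilityMeasure ν] {N : ℕ}
    {f : (Fin N → Y) → ℝ} (hf : LipschitzWith 1 f) (n : Fin N) :
    LipschitzWith 1 (integrateOut ν n f) := by
  refine LipschitzWith.of_dist_le_mul fun x y => ?_
  rw [NNReal.coe_one, one_mul, Real.dist_eq, _root_.integrateOut, _root_.integrateOut,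
    ← integral_sub (hf.integrable_update n x) (hf.integrable_update n y)]
  have := norm_integral_le_of_norm_le_const (μ := ν) (C := dist x y)
    (f := fun t => f (Function.update x n t) - f (Function.update y n t))
    (Filter.Eventually.of_forall fun t => ?_)
  · simpa using this
  · have h := hf.dist_le_mul (Function.update x n t) (Function.update y n t)
    rw [NNReal.coe_one, one_mul, Real.dist_eq] at h
    refine h.trans ((dist_pi_le_iff dist_nonneg).2 fun m => ?_)
    by_cases hm : m = n
    · subst hm
      simp
    · simpa [hm] using dist_le_pi_dist x y m

/-- A uniform approximation of a Lipschitz function by a function of rounded coordinates survives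
integrating out coordinates. -/
theorem abs_condExpOn_sub_le {X Y : Type*} [MeasurableSpace X] [Finite X]
    [MeasurableSingletonClass X] [MetricSpace Y] [CompactSpace Y]
    [MeasurableSpace Y] [BorelSpace Y] {μ : Measure X} {ν : Measure Y} [IsProbabilityMeasure ν]
    {N : ℕ} {r : Fin N → Y → X} (hr : ∀ n, MeasurePreserving (r n) ν μ) {f : (Fin N → Y) → ℝ}
    (hf : LipschitzWith 1 f) {G : (Fin N → X) → ℝ} {δ : ℝ}
    (hfG : ∀ x, |f x - G fun m => r m (x m)| ≤ δ) (S : Finset (Fin N)) (x : Fin N → Y) :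
    |condExpOn ν S f x - condExpOn μ S G fun m => r m (x m)| ≤ δ := by
  have key : ∀ l : List (Fin N), LipschitzWith 1 (l.foldr (integrateOut ν) f) ∧
      ∀ x, |l.foldr (integrateOut ν) f x - l.foldr (integrateOut μ) G fun m => r m (x m)| ≤ δ := by
    intro l
    induction l with
    | nil => exact ⟨hf, hfG⟩
    | cons n l ih =>
      simp only [List.foldr_cons]
      generalize l.foldr (integrateOut ν) f = f' at ih ⊢
      generalize l.foldr (integrateOut μ) G = G' at ih ⊢
      refine ⟨ih.1.integrateOut n, fun x => ?_⟩
      have hupd : Measurable fun y => Function.update x n y :=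
        (continuous_const.update n continuous_id).measurable
      have hint : Integrable (fun y => G' fun m => r m (Function.update x n y m)) ν := by
        obtain ⟨C, hC⟩ := (Set.finite_range fun c => ‖G' c‖).bddAbove
        refine Integrable.of_bound (Measurable.aestronglyMeasurable ?_) C
          (Filter.Eventually.of_forall fun y => hC ⟨_, rfl⟩)
        exact (measurable_of_countable G').comp (measurable_pi_lambda _ fun m =>
          (hr m).measurable.comp ((measurable_pi_apply m).comp hupd))
      rw [← integrateOut_comp hr, integrateOut, integrateOut,
        ← integral_sub (ih.1.integrable_update n x) hint]
      have := norm_integral_le_of_norm_le_const (μ := ν) (C := δ)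
        (f := fun y => f' (Function.update x n y) - G' fun m => r m (Function.update x n y m))
        (Filter.Eventually.of_forall fun y => ih.2 (Function.update x n y))
      simpa using this
  exact (key _).2 x

/-- Rounding the circle to the grid of `M` equidistant points preserves the uniform measures. -/
theorem exists_measurePreserving_rounding (M : ℕ) [NeZero M] :
    ∃ r : UnitAddCircle → Fin M,
      MeasurePreserving r volume (PMF.uniformOfFintype (Fin M)).toMeasure ∧
        ∀ x, dist x (((r x : ℕ) / M : ℝ) : UnitAddCircle) ≤ 1 / M := by
  have hM : (0 : ℝ) < M := by exact_mod_cast Nat.pos_of_neZero M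
  -- The representative in `(0, 1]`; the half-open intervals then match `Nat.ceil`.
  set e : UnitAddCircle → ℝ := fun x => (AddCircle.measurableEquivIoc 1 0 x : ℝ) with he
  have hem : Measurable e := measurable_subtype_coe.comp (AddCircle.measurableEquivIoc 1 0).measurable
  have he0 : ∀ x, 0 < e x := fun x => (AddCircle.measurableEquivIoc 1 0 x).2.1
  have he1 : ∀ x, e x ≤ 1 := fun x => by
    simpa using (AddCircle.measurableEquivIoc (1 : ℝ) 0 x).2.2
  have hec : ∀ x, (e x : UnitAddCircle) = x := fun x =>
    (AddCircle.measurableEquivIoc (1 : ℝ) 0).symm_apply_apply x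
  have hce : ∀ t : ℝ, t ∈ Set.Ioc (0 : ℝ) (0 + 1) → e t = t := fun t ht =>
    congrArg Subtype.val (AddCircle.equivIoc_coe_eq (p := (1 : ℝ)) ht)
  have hpos : ∀ x, 1 ≤ ⌈M * e x⌉₊ := fun x => Nat.ceil_pos.2 (mul_pos hM (he0 x))
  have hlt : ∀ x, ⌈M * e x⌉₊ - 1 < M := fun x => by
    have : ⌈M * e x⌉₊ ≤ M := Nat.ceil_le.2 (mul_le_of_le_one_right hM.le (he1 x))
    have := hpos x
    omega
  obtain ⟨r, hr⟩ : ∃ r : UnitAddCircle → Fin M, r = fun x => ⟨⌈M * e x⌉₊ - 1, hlt x⟩ := ⟨_, rfl⟩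
  have hrj : ∀ x (j : Fin M), r x = j ↔ (j : ℝ) / M < e x ∧ e x ≤ ((j : ℝ) + 1) / M := fun x j => by
    have h1 : r x = j ↔ ⌈M * e x⌉₊ = (j : ℕ) + 1 := by
      rw [hr, Fin.ext_iff]
      have := hpos x
      dsimp only
      omega
    rw [h1, Nat.ceil_eq_iff (Nat.succ_ne_zero _), div_lt_iff₀' hM, le_div_iff₀' hM]
    simp
  have hrm : Measurable r := by
    refine measurable_to_countable' fun j => ?_
    have : r ⁻¹' {j} = e ⁻¹' Set.Ioc ((j : ℝ) / M) (((j : ℝ) + 1) / M) := by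
      ext x
      simpa using hrj x j
    rw [this]
    exact hem measurableSet_Ioc
  refine ⟨r, ⟨hrm, ?_⟩, fun x => ?_⟩
  · refine Measure.ext_of_singleton fun j => ?_
    rw [Measure.map_apply hrm (measurableSet_singleton j),
      AddCircle.add_projection_respects_measure 1 0 (hrm (measurableSet_singleton j)),
      PMF.toMeasure_apply_singleton _ _ (measurableSet_singleton j), PMF.uniformOfFintype_apply,
      Fintype.card_fin]
    have : QuotientAddGroup.mk ⁻¹' (r ⁻¹' {j}) ∩ Set.Ioc (0 : ℝ) (0 + 1) =
        Set.Ioc ((j : ℝ) / M) (((j : ℝ) + 1) / M) := by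
      ext t
      have h2 : ((j : ℝ) + 1) / M ≤ 1 := by
        rw [div_le_one hM]
        exact_mod_cast j.2
      have h3 : (0 : ℝ) ≤ (j : ℝ) / M := by positivity
      constructor
      · rintro ⟨h, ht⟩
        have := (hrj t j).1 h
        rwa [hce t ht] at this
      · rintro ⟨h, h'⟩
        have ht : t ∈ Set.Ioc (0 : ℝ) (0 + 1) := ⟨by linarith, by linarith⟩
        refine ⟨(hrj t j).2 ?_, ht⟩
        rw [hce t ht]
        exact ⟨h, h'⟩
    rw [this, Real.volume_Ioc, ← sub_div, add_sub_cancel_left, one_div,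
      ENNReal.ofReal_inv_of_pos hM, ENNReal.ofReal_natCast]
  · have h := (hrj x (r x)).1 rfl
    have h2 := lipschitzWith_coe_unitAddCircle.dist_le_mul (e x) ((r x : ℕ) / M : ℝ)
    rw [hec, NNReal.coe_one, one_mul, Real.dist_eq] at h2
    refine h2.trans ?_
    rw [abs_of_nonneg (by linarith [h.1])]
    have := h.2
    rw [add_div] at this
    linarith

theorem integral_pi_uniform {X : Type*} [Fintype X] [Nonempty X] [MeasurableSpace X]
    [MeasurableSingletonClass X] {N : ℕ} (h : (Fin N → X) → ℝ) :
    ∫ c, h c ∂(Measure.pi fun _ : Fin N => (PMF.uniformOfFintype X).toMeasure) =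
      (∑ c, h c) / (Fintype.card X : ℝ) ^ N := by
  classical
  rw [integral_fintype (Integrable.of_finite)]
  simp only [measureReal_def, Measure.pi_singleton,
    PMF.toMeasure_apply_singleton _ _ (measurableSet_singleton _), PMF.uniformOfFintype_apply]
  simp [Finset.mul_sum, div_eq_inv_mul]

theorem theorem1p2 :
    ∀ ε : ℝ, 0 < ε → ∃ q : ℕ, 1 ≤ q ∧
      ∀ (N : ℕ) (f : (Fin N → UnitAddCircle) → ℝ), LipschitzWith 1 f →
        ∃ S : Finset (Fin N), S.card ≤ q ∧
          eLpNorm (f - condExpOn (volume : Measure UnitAddCircle) S f) 1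
            (Measure.pi fun _ : Fin N => (volume : Measure UnitAddCircle))
              < ENNReal.ofReal ε := by
  intro ε hε
  obtain ⟨M, hMε⟩ := exists_nat_gt (4 / ε)
  have hM : (0 : ℝ) < M := lt_trans (by positivity) hMε
  have : NeZero M := ⟨by rintro rfl; simp at hM⟩
  obtain ⟨q, hq⟩ := exists_averageOutside_close (Fin M) (η := (ε / 4) ^ 2) (by positivity)
  obtain ⟨r, hr, hrd⟩ := exists_measurePreserving_rounding M
  rw [Fintype.card_fin] at hq
  refine ⟨max q 1, le_max_right _ _, fun N f hf => ?_⟩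
  have hp : ∀ i j : Fin M, |((i : ℕ) / M : ℝ) - (j : ℕ) / M| ≤ 1 := fun i j => by
    rw [← sub_div, abs_div, abs_of_pos hM, div_le_one hM, abs_le]
    have h1 : ((i : ℕ) : ℝ) < M := by exact_mod_cast i.2
    have h2 : ((j : ℕ) : ℝ) < M := by exact_mod_cast j.2
    have h3 : (0 : ℝ) ≤ (i : ℕ) := Nat.cast_nonneg _
    have h4 : (0 : ℝ) ≤ (j : ℕ) := Nat.cast_nonneg _
    constructor <;> linarith
  -- `F` samples `f` on a grid of mesh `1 / M` in each coordinate, translated by `u`.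
  obtain ⟨u, hu⟩ := exists_translate_sum_coordLaplacian_le hp hf
  set F : (Fin N → Fin M) → ℝ := fun c => f fun m => u m + (((c m : ℕ) / M : ℝ) : UnitAddCircle)
    with hF
  -- The circle has diameter `1 / 2`, so that `f` and `F` have oscillation at most `1`.
  have hosc : ∀ c c', |F c - F c'| ≤ 1 := fun c c' => by
    have h := hf.dist_le_mul (fun m => u m + (((c m : ℕ) / M : ℝ) : UnitAddCircle))
      fun m => u m + (((c' m : ℕ) / M : ℝ) : UnitAddCircle)
    rw [NNReal.coe_one, one_mul, Real.dist_eq] at h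
    refine h.trans ((dist_pi_le_iff zero_le_one).2 fun m => ?_)
    rw [dist_eq_norm]
    refine (AddCircle.norm_le_half_period 1 one_ne_zero).trans ?_
    norm_num
  have hbd : ∀ n c, |coordLaplacian n F c| ≤ 1 := fun n c => by
    refine (abs_coordLaplacian_le n F c).trans ?_
    rw [Fintype.card_fin, div_le_one hM]
    calc ∑ y, |F (Function.update c n y) - F c| ≤ ∑ _y : Fin M, (1 : ℝ) :=
          Finset.sum_le_sum fun y _ => hosc _ _
      _ = M := by simp
  rw [Fintype.card_fin] at hu
  obtain ⟨S, hSq, hS⟩ := hq N F hbd hu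
  refine ⟨S, hSq.trans (le_max_left _ _), ?_⟩
  -- Rounding to the translated grid.
  set ρ : Fin N → UnitAddCircle → Fin M := fun n x => r (x - u n) with hρ
  have hρm : ∀ n, MeasurePreserving (ρ n) volume (PMF.uniformOfFintype (Fin M)).toMeasure :=
    fun n => hr.comp (measurePreserving_sub_right volume (u n))
  have hfF : ∀ x, |f x - F fun m => ρ m (x m)| ≤ 1 / M := fun x => by
    have h := hf.dist_le_mul x fun m => u m + (((ρ m (x m) : ℕ) / M : ℝ) : UnitAddCircle)
    rw [NNReal.coe_one, one_mul, Real.dist_eq] at h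
    refine h.trans ((dist_pi_le_iff (by positivity)).2 fun m => ?_)
    have := hrd (x m - u m)
    rwa [dist_eq_norm, sub_sub, ← dist_eq_norm] at this
  set R : (Fin N → UnitAddCircle) → Fin N → Fin M := fun x m => ρ m (x m) with hR
  have hRm : MeasurePreserving R (Measure.pi fun _ => volume)
      (Measure.pi fun _ => (PMF.uniformOfFintype (Fin M)).toMeasure) :=
    measurePreserving_pi _ _ hρm
  have hE := abs_condExpOn_sub_le hρm hf hfF S
  rw [condExpOn_uniform] at hE
  -- Two errors `1 / M`, from replacing `f` by `F` and its average by that of `F`.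
  set D : (Fin N → Fin M) → ℝ := fun c => 2 / M + |F c - averageOutside S F c| with hD
  have hD0 : ∀ c, 0 ≤ D c := fun c => by positivity
  have hpt : ∀ x, ‖(f - condExpOn volume S f) x‖ ≤ (D ∘ R) x := fun x => by
    have h1 := abs_le.1 (hfF x)
    have h2 := abs_le.1 (hE x)
    have h3 := abs_le.1 (le_refl |F (R x) - averageOutside S F (R x)|)
    have h4 : (2 : ℝ) / M = 1 / M + 1 / M := by ring
    rw [Pi.sub_apply, Real.norm_eq_abs, abs_le, Function.comp_apply]
    simp only [hD, h4]
    constructor <;> linarith [h1.1, h1.2, h2.1, h2.2, h3.1, h3.2]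
  have hMN : (0 : ℝ) < (M : ℝ) ^ N := pow_pos hM N
  have hL1 : ∑ c, |F c - averageOutside S F c| ≤ ε / 4 * (M : ℝ) ^ N := by
    refine le_of_sq_le_sq ?_ (by positivity)
    have h := Finset.sum_mul_sq_le_sq_mul_sq Finset.univ (fun _ : Fin N → Fin M => (1 : ℝ))
      fun c => |F c - averageOutside S F c|
    simp only [one_mul, one_pow, sq_abs, Finset.sum_const, Finset.card_univ, nsmul_eq_mul,
      mul_one] at h
    refine h.trans ?_
    calc (Fintype.card (Fin N → Fin M) : ℝ) * ∑ c, (F c - averageOutside S F c) ^ 2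
        ≤ (M : ℝ) ^ N * ((ε / 4) ^ 2 * (M : ℝ) ^ N) := by
          rw [Fintype.card_fun, Fintype.card_fin, Fintype.card_fin, Nat.cast_pow]
          gcongr
      _ = _ := by ring
  calc eLpNorm (f - condExpOn volume S f) 1 (Measure.pi fun _ => volume)
      ≤ eLpNorm (D ∘ R) 1 (Measure.pi fun _ => volume) := eLpNorm_mono_real hpt
    _ = eLpNorm D 1 (Measure.pi fun _ => (PMF.uniformOfFintype (Fin M)).toMeasure) :=
        eLpNorm_comp_measurePreserving (measurable_of_countable _).aestronglyMeasurable hRm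
    _ = ENNReal.ofReal ((∑ c, D c) / (M : ℝ) ^ N) := by
        rw [eLpNorm_one_eq_lintegral_enorm, ← ofReal_integral_norm_eq_lintegral_enorm
          Integrable.of_finite, integral_pi_uniform, Fintype.card_fin]
        simp only [Real.norm_of_nonneg (hD0 _)]
    _ < ENNReal.ofReal ε := by
        rw [ENNReal.ofReal_lt_ofReal_iff hε, div_lt_iff₀ hMN]
        have hsum : ∑ c, D c = 2 / M * (M : ℝ) ^ N + ∑ c, |F c - averageOutside S F c| := by
          simp [hD, Finset.sum_add_distrib, mul_comm]
        have h2 : 2 / (M : ℝ) < ε / 2 := by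
          rw [div_lt_div_iff₀ hM two_pos]
          rw [div_lt_iff₀ hε] at hMε
          linarith
        rw [hsum]
        nlinarith
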